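/- Let $\Omega=\{0,1\}^{\infty}$ be the set of infinite strings $\omega=\omega_0\omega_1\omega_2\cdots$ with the lexicographic order $\preceq$; intervals of strings refer to this order. Let $S(\omega_0\omega_1\omega_2\cdots)=\omega_1\omega_2\cdots$ be the shift. A pair $(\alpha,\beta)$ in $\Omega$ is admissible if $\alpha_0\alpha_1=01$, $\beta_0\beta_1=10$, and $S^n\alpha\notin(\alpha,\beta]$, $S^n\beta\notin[\alpha,\beta)$ for all $n\ge 0$. Put $$\Omega_{(\alpha,\beta,-)}=\{\omega: S^n\omega\notin(\alpha,\beta]\ \forall n\ge 0\},\qquad \Omega_{(\alpha,\beta,+)}=\{\omega: S^n\omega\notin[\alpha,\beta)\ \forall n\ge 0\},$$ $$\Omega^0_{(\alpha,\beta,-)}=\{\omega\in\Omega_{(\alpha,\beta,-)}: 0\omega\preceq\alpha\},\qquad \Omega^0_{(\alpha,\beta,+)}=\{\omega\in\Omega_{(\alpha,\beta,+)}: 0\omega\prec\alpha\}.$$ The pair is null if $\limsup_{n\to\infty}\frac1n\ln|\Gamma_n|=0$, where $\Gamma_n$ is the set of initial segments of length $n$ of the strings in $\Omega_{(\alpha,\beta,-)}\cup\Omega_{(\alpha,\beta,+)}$.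 For an admissible non-null pair, let $b$ be the least solution in $[\frac12,1)$ of $\sum_{n\ge 0}\alpha_nx^n=\sum_{n\ge 0}\beta_nx^n$ and let $B=1/b$. For either choice of sign $\pm$ let $\Gamma$ be the set of all decimals $\omega_0\cdots\omega_N\bullet\omega_{N+1}\omega_{N+2}\cdots$ ($N\ge 0$) with $\omega_0\omega_1\omega_2\cdots\in\Omega^0_{(\alpha,\beta,\pm)}$, and let $$\pi(\omega_0\cdots\omega_N\bullet\omega_{N+1}\cdots)=\sum_{n=-\infty}^{N}\omega_{N-n}B^n .$$ For a finite string $s$ let $T'_s$ be the set of all $\pi(\omega)$ with $\omega\in\Gamma$ whose part to the left of the point is $s$. The tiles are the closures $T_s=\overline{T'_s}$ of the nonempty sets $T'_s$, and $\mathcal T_{(\alpha,\beta)}$ is the set of all tiles. Theorem. Let $(\alpha,\beta)$ be an admissible non-null pair, and let $\mathcal T=\mathcal T_{(\alpha,\beta)}$, formed with either choice of sign. 1. $\mathcal T$ is self-replicating: for every tile $T\in\mathcal T$, the set $BT=\{Bx:x\in T\}$ is a union of tiles of $\mathcal T$. 2. If $\alpha$ and $\beta$ are eventually periodic (for some $m\ge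 0$ the $m$-th shift is the infinite repetition of a nonempty finite string), then the tiles of $\mathcal T$ have only finitely many distinct lengths, where the length of a tile is its diameter. -/

import Mathlib

namespace RadixTiling

/-- `Ω`: infinite strings `ω₀ ω₁ ω₂ ⋯` of digits `0, 1`. -/
abbrev Str : Type := ℕ → Fin 2

/-- The shift operator `S (ω₀ ω₁ ω₂ ⋯) = ω₁ ω₂ ⋯`. -/
def shift (ω : Str) : Str := fun n => ω (n + 1)

/-- The string `0 ω₀ ω₁ ω₂ ⋯`. -/
def zeroCons (ω : Str) : Str := fun n => Nat.casesOn n 0 ω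

/-- Admissible pairs. The order on `Lex Str` is the lexicographic order. -/
structure IsAdmissible (α β : Str) : Prop where
  alpha_zero : α 0 = 0
  alpha_one : α 1 = 1
  beta_zero : β 0 = 1
  beta_one : β 1 = 0
  alpha_shift : ∀ n : ℕ, toLex (shift^[n] α) ∉ Set.Ioc (toLex α) (toLex β)
  beta_shift : ∀ n : ℕ, toLex (shift^[n] β) ∉ Set.Ico (toLex α) (toLex β)

/-- The sign `-` or `+` that distinguishes the two address spaces of a pair. -/
inductive Side : Type
  | minus
  | plus

/-- `Ω_{(α,β,-)}` and `Ω_{(α,β,+)}`. -/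
def addressSpace (α β : Str) : Side → Set Str
  | .minus => {ω | ∀ n : ℕ, toLex (shift^[n] ω) ∉ Set.Ioc (toLex α) (toLex β)}
  | .plus => {ω | ∀ n : ℕ, toLex (shift^[n] ω) ∉ Set.Ico (toLex α) (toLex β)}

/-- `Ω⁰_{(α,β,-)}` and `Ω⁰_{(α,β,+)}`. -/
def addressSpaceZero (α β : Str) : Side → Set Str
  | .minus => {ω ∈ addressSpace α β .minus | toLex (zeroCons ω) ≤ toLex α}
  | .plus => {ω ∈ addressSpace α β .plus | toLex (zeroCons ω) < toLex α}

/-- The set `Γ_n` of initial segments of length `n` of the strings in `Γ`. -/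
def initialSegments (Γ : Set Str) (n : ℕ) : Set (Fin n → Fin 2) :=
  (fun (γ : Str) (i : Fin n) => γ i) '' Γ

/-- The exponential growth rate `h(Γ) = limsup (1/n) ln |Γ_n|`. -/
noncomputable def growthRate (Γ : Set Str) : ℝ :=
  Filter.limsup (fun n : ℕ => (1 / (n : ℝ)) * Real.log ((initialSegments Γ n).ncard : ℝ))
    Filter.atTop

/-- The pair `(α, β)` is null if `Ω_{(α,β)} = Ω_{(α,β,-)} ∪ Ω_{(α,β,+)}` has growth rate `0`. -/
def IsNull (α β : Str) : Prop :=
  growthRate (addressSpace α β .minus ∪ addressSpace α β .plus) = 0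

/-- A periodic string: infinite repetition of a nonempty finite string. -/
def IsPeriodic (ω : Str) : Prop := ∃ p : ℕ, 0 < p ∧ Function.Periodic ω p

/-- An eventually periodic string. -/
def IsEventuallyPeriodic (ω : Str) : Prop := ∃ m : ℕ, IsPeriodic (shift^[m] ω)

/-- The decimal `ω₀ ω₁ ⋯ ω_N • ω_{N+1} ω_{N+2} ⋯`, with `ω = digits` and `N = point`. -/
structure Decimal : Type where
  digits : Str
  point : ℕ

/-- The finite string `ω₀ ω₁ ⋯ ω_N` to the left of the point. -/
def Decimal.integerPart (ω : Decimal) : List (Fin 2) :=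
  List.ofFn (fun i : Fin (ω.point + 1) => ω.digits i)

/-- `Γ^•`: all decimals obtained by placing the point anywhere in a string of `Γ`. -/
def withPoint (Γ : Set Str) : Set Decimal := {ω | ω.digits ∈ Γ}

/-- The radix map in base `B`:
`ω₀ ⋯ ω_N • ω_{N+1} ⋯ ↦ ∑_{n = -∞}^{N} ω_{N-n} B^n = ∑_{k = 0}^{∞} ω_k B^{N-k}`. -/
noncomputable def radixMap (B : ℝ) (ω : Decimal) : ℝ :=
  ∑' k : ℕ, ((ω.digits k : ℕ) : ℝ) * B ^ ((ω.point : ℤ) - (k : ℤ))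

/-- The solutions in `[1/2, 1)` of `∑ αₙ xⁿ = ∑ βₙ xⁿ`. -/
def solutions (α β : Str) : Set ℝ :=
  {x ∈ Set.Ico (1 / 2 : ℝ) 1 |
    ∑' n : ℕ, ((α n : ℕ) : ℝ) * x ^ n = ∑' n : ℕ, ((β n : ℕ) : ℝ) * x ^ n}

/-- The base `B_{(α,β)} = 1 / b`, where `b` is the least solution in `[1/2, 1)`. -/
noncomputable def base (α β : Str) : ℝ := 1 / sInf (solutions α β)

/-- `T'_s`: the values of the decimals in `Γ` whose integer part is `s`. -/
def preTile (Γ : Set Decimal) (π : Decimal → ℝ) (s : List (Fin 2)) : Set ℝ :=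
  π '' {ω ∈ Γ | ω.integerPart = s}

/-- The set of tiles: the closures of the nonempty sets `T'_s`. -/
def tiling (Γ : Set Decimal) (π : Decimal → ℝ) : Set (Set ℝ) :=
  {T | ∃ s : List (Fin 2), (preTile Γ π s).Nonempty ∧ T = closure (preTile Γ π s)}

/-- The tiling `T_{(α,β)}` of the radix system `R(α,β,-)` or `R(α,β,+)`. -/
noncomputable def pairTiling (α β : Str) (ε : Side) : Set (Set ℝ) :=
  tiling (withPoint (addressSpaceZero α β ε)) (radixMap (base α β))

/-- `B(𝒯) = {B T : T ∈ 𝒯}`. -/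
def scaledTiling (B : ℝ) (𝒯 : Set (Set ℝ)) : Set (Set ℝ) :=
  (fun T : Set ℝ => (fun x : ℝ => B * x) '' T) '' 𝒯

/-- Each tile of `B(𝒯)` is a union of tiles of `𝒯`. -/
def IsSelfReplicating (B : ℝ) (𝒯 : Set (Set ℝ)) : Prop :=
  ∀ T ∈ scaledTiling B 𝒯, ∃ 𝒮 ⊆ 𝒯, T = ⋃₀ 𝒮

/-- The set of lengths of tiles; the length of a bounded interval is its diameter. -/
noncomputable def tileLengths (𝒯 : Set (Set ℝ)) : Set ℝ := Metric.diam '' 𝒯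

end RadixTiling

namespace RadixTiling

open Set

/-! ### Strings, prefixes and the lexicographic order -/

/-! Multiplying by `B` moves the point one digit to the right, so `B T'_s = T'_{s0} ∪ T'_{s1}`. For
`B ≠ 0` closure commutes with this scaling and with finite unions, which is self-replication
(`image_mul_preTile`). For lengths, `T'_s` is a translate of the set of values `• τ` over the tails
`τ` admitted by `s` (`preTile_eq_image`). Whether `sτ` is admitted depends only on whether `τ` lies
in the address space and on how `τ` compares with the shifts of `α` and `β`. When these shifts are
finite in number, only finitely many tail sets occur (`finite_saturated`), hence finitely many
diameters. -/

/-- The string `c ω₀ ω₁ ω₂ ⋯`. -/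
def cons (c : Fin 2) (ω : Str) : Str := fun n => Nat.casesOn n c ω

/-- The string `s ω₀ ω₁ ω₂ ⋯` for a finite string `s`. -/
def prepend (s : List (Fin 2)) (ω : Str) : Str := s.foldr cons ω

@[simp] theorem cons_zero (c : Fin 2) (ω : Str) : cons c ω 0 = c := rfl

@[simp] theorem cons_succ (c : Fin 2) (ω : Str) (n : ℕ) : cons c ω (n + 1) = ω n := rfl

@[simp] theorem shift_cons (c : Fin 2) (ω : Str) : shift (cons c ω) = ω := rfl

theorem cons_shift (ω : Str) : cons (ω 0) (shift ω) = ω := by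
  funext n
  cases n <;> rfl

@[simp] theorem prepend_nil (ω : Str) : prepend [] ω = ω := rfl

@[simp] theorem prepend_cons (c : Fin 2) (s : List (Fin 2)) (ω : Str) :
    prepend (c :: s) ω = cons c (prepend s ω) := rfl

theorem shift_iterate_apply (n : ℕ) (ω : Str) (k : ℕ) : shift^[n] ω k = ω (n + k) := by
  induction n generalizing ω with
  | zero => simp
  | succ n ih =>
    rw [Function.iterate_succ_apply, ih]
    exact congrArg ω (by omega)

theorem shift_iterate_prepend (s : List (Fin 2)) (ω : Str) :
    shift^[s.length] (prepend s ω) = ω := by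
  induction s with
  | nil => rfl
  | cons c s ih => rw [List.length_cons, Function.iterate_succ_apply, prepend_cons, shift_cons, ih]

theorem prepend_apply_of_lt (s : List (Fin 2)) (ω : Str) {k : ℕ} (hk : k < s.length) :
    prepend s ω k = s[k] := by
  induction s generalizing k with
  | nil => simp at hk
  | cons c s ih =>
    cases k with
    | zero => rfl
    | succ k => simpa using ih (by simpa using hk)

theorem prepend_ofFn (n : ℕ) (ω : Str) :
    prepend (List.ofFn fun i : Fin n => ω i) (shift^[n] ω) = ω := by
  induction n generalizing ω with
  | zero => simp
  | succ n ih =>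
    rw [List.ofFn_succ, prepend_cons, Function.iterate_succ_apply]
    exact (congrArg (cons (ω 0)) (ih (shift ω))).trans (cons_shift ω)

theorem toLex_lt_iff (x y : Str) :
    toLex x < toLex y ↔ x 0 < y 0 ∨ x 0 = y 0 ∧ toLex (shift x) < toLex (shift y) := by
  constructor
  · rintro ⟨i, hi, hlt⟩
    cases i with
    | zero => exact Or.inl hlt
    | succ i =>
      exact Or.inr ⟨hi 0 (Nat.succ_pos i), i, fun j hj => hi (j + 1) (Nat.succ_lt_succ hj), hlt⟩
  · rintro (h | ⟨h, i, hi, hlt⟩)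
    · exact ⟨0, fun j hj => absurd hj (Nat.not_lt_zero j), h⟩
    · refine ⟨i + 1, fun j hj => ?_, hlt⟩
      cases j with
      | zero => exact h
      | succ j => exact hi j (Nat.lt_of_succ_lt_succ hj)

theorem toLex_le_iff (x y : Str) :
    toLex x ≤ toLex y ↔ x 0 < y 0 ∨ x 0 = y 0 ∧ toLex (shift x) ≤ toLex (shift y) := by
  have hx : toLex x ≤ toLex y ↔ ¬ toLex y < toLex x := not_lt.symm
  have hs : toLex (shift x) ≤ toLex (shift y) ↔ ¬ toLex (shift y) < toLex (shift x) := not_lt.symm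
  rw [hx, hs, toLex_lt_iff y x]
  rcases lt_trichotomy (x 0) (y 0) with h | h | h
  · simp [h, h.not_gt, h.ne']
  · simp [h]
  · simp [h, h.not_gt, h.ne']

theorem zero_mem_addressSpaceZero {α β : Str} (h : IsAdmissible α β) (ε : Side) :
    (fun _ => 0 : Str) ∈ addressSpaceZero α β ε := by
  have hs : ∀ n : ℕ, shift^[n] (fun _ => 0 : Str) = fun _ => 0 := fun n =>
    funext fun k => shift_iterate_apply n _ k
  have hz : zeroCons (fun _ => 0) = fun _ => 0 := by
    funext k
    cases k <;> rfl
  have hlt : toLex (fun _ => 0 : Str) < toLex α := by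
    rw [toLex_lt_iff, toLex_lt_iff]
    refine Or.inr ⟨h.alpha_zero.symm, Or.inl ?_⟩
    change 0 < α 1
    rw [h.alpha_one]
    decide
  cases ε with
  | minus => exact ⟨fun n hn => hn.1.not_ge (by rw [hs]; exact hlt.le), by rw [hz]; exact hlt.le⟩
  | plus => exact ⟨fun n hn => hn.1.not_gt (by rw [hs]; exact hlt), by rw [hz]; exact hlt⟩

/-! ### The base -/

/-- Existence of a solution is not needed for the bounds `0 ≤ b < 1`: with no solution, `sInf ∅ =
0`, and the base becomes `1 / 0 = 0`. -/
theorem sInf_solutions_nonneg (α β : Str) : 0 ≤ sInf (solutions α β) :=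
  Real.sInf_nonneg fun _ hx => one_half_pos.le.trans hx.1.1

theorem sInf_solutions_lt_one (α β : Str) : sInf (solutions α β) < 1 := by
  rcases (solutions α β).eq_empty_or_nonempty with h | ⟨x, hx⟩
  · rw [h, Real.sInf_empty]
    exact one_pos
  · exact (csInf_le ⟨1 / 2, fun _ hy => hy.1.1⟩ hx).trans_lt hx.1.2

/-! ### Self-replication -/

theorem integerPart_succ (ω : Str) (N : ℕ) :
    (Decimal.mk ω (N + 1)).integerPart = (Decimal.mk ω N).integerPart ++ [ω (N + 1)] := by
  exact List.ofFn_succ_last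

theorem length_integerPart (ω : Decimal) : ω.integerPart.length = ω.point + 1 := by
  simp [Decimal.integerPart]

theorem radixMap_succ {B : ℝ} (hB : B ≠ 0) (ω : Str) (N : ℕ) :
    radixMap B ⟨ω, N + 1⟩ = B * radixMap B ⟨ω, N⟩ := by
  simp only [radixMap, ← tsum_mul_left]
  congr 1
  funext k
  have : ((N + 1 : ℕ) : ℤ) - k = 1 + ((N : ℤ) - k) := by push_cast; ring
  rw [this, zpow_add₀ hB, zpow_one]
  ring

/-- The digit `c` is the one the point jumps over. The empty `s` is excluded because every decimal
has at least one digit left of the point. -/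
theorem image_mul_preTile {B : ℝ} (hB : B ≠ 0) (Z : Set Str) {s : List (Fin 2)} (hs : s ≠ []) :
    (fun x => B * x) '' preTile (withPoint Z) (radixMap B) s =
      ⋃ c : Fin 2, preTile (withPoint Z) (radixMap B) (s ++ [c]) := by
  ext x
  simp only [mem_iUnion]
  constructor
  · rintro ⟨_, ⟨⟨ω, N⟩, ⟨hω, rfl⟩, rfl⟩, rfl⟩
    exact ⟨ω (N + 1), ⟨ω, N + 1⟩, ⟨hω, integerPart_succ ω N⟩, radixMap_succ hB ω N⟩
  · rintro ⟨c, ⟨ω, M⟩, ⟨hω, h⟩, rfl⟩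
    have hlen := congrArg List.length h
    rw [length_integerPart] at hlen
    cases M with
    | zero => simp [hs] at hlen
    | succ N =>
      rw [integerPart_succ] at h
      exact ⟨_, ⟨⟨ω, N⟩, ⟨hω, (List.append_inj' h rfl).1⟩, rfl⟩, (radixMap_succ hB ω N).symm⟩

theorem ne_nil_of_preTile_nonempty {Γ : Set Decimal} {π : Decimal → ℝ} {s : List (Fin 2)}
    (h : (preTile Γ π s).Nonempty) : s ≠ [] := by
  obtain ⟨_, ω, ⟨_, rfl⟩, _⟩ := h
  exact List.ne_nil_of_length_pos (by rw [length_integerPart]; omega)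

theorem isSelfReplicating_tiling {B : ℝ} (hB : B ≠ 0) (Z : Set Str) :
    IsSelfReplicating B (tiling (withPoint Z) (radixMap B)) := by
  rintro _ ⟨_, ⟨s, hs, rfl⟩, rfl⟩
  refine ⟨{T | ∃ c : Fin 2, (preTile (withPoint Z) (radixMap B) (s ++ [c])).Nonempty ∧
    T = closure (preTile (withPoint Z) (radixMap B) (s ++ [c]))}, ?_, ?_⟩
  · rintro T ⟨c, h⟩
    exact ⟨s ++ [c], h⟩
  · dsimp only
    have himage : (fun x => B * x) '' closure (preTile (withPoint Z) (radixMap B) s) =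
        closure ((fun x => B * x) '' preTile (withPoint Z) (radixMap B) s) :=
      (Homeomorph.mulLeft₀ B hB).image_closure _
    rw [himage, image_mul_preTile hB Z (ne_nil_of_preTile_nonempty hs), closure_iUnion_of_finite]
    ext x
    simp only [mem_iUnion, mem_sUnion]
    constructor
    · rintro ⟨c, hx⟩
      -- An empty `T'_{sc}` is not a tile, but its closure contributes no point.
      exact ⟨_, ⟨c, closure_nonempty_iff.1 ⟨x, hx⟩, rfl⟩, hx⟩
    · rintro ⟨_, ⟨c, _, rfl⟩, hx⟩
      exact ⟨c, hx⟩

/-- In base `0` every scaled tile is `{0}`, and `{0}` is itself the tile of the string `0`: since `0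
^ 0 = 1`, a decimal is worth its last digit before the point. -/
theorem isSelfReplicating_zero {Z : Set Str} (hZ : (fun _ => 0 : Str) ∈ Z) :
    IsSelfReplicating 0 (tiling (withPoint Z) (radixMap 0)) := by
  rintro _ ⟨_, ⟨s, hs, rfl⟩, rfl⟩
  have hzero : ∀ t : Decimal, t.integerPart = [0] → radixMap 0 t = 0 := by
    rintro ⟨ω, N⟩ h
    have hN : N = 0 := by simpa [length_integerPart] using congrArg List.length h
    subst hN
    have h0 : ω 0 = 0 := by simpa [Decimal.integerPart] using h
    refine (tsum_congr fun k => ?_).trans tsum_zero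
    cases k with
    | zero => simp [h0]
    | succ k =>
      have : ((0 : ℕ) : ℤ) - ((k + 1 : ℕ) : ℤ) ≠ 0 := by push_cast; omega
      rw [zero_zpow _ this, mul_zero]
  have htile : preTile (withPoint Z) (radixMap 0) [0] = {0} := by
    have hmem : (Decimal.mk (fun _ => 0) 0).integerPart = [0] := by simp [Decimal.integerPart]
    refine Subset.antisymm ?_ (singleton_subset_iff.2 ⟨⟨fun _ => 0, 0⟩, ⟨hZ, hmem⟩, hzero _ hmem⟩)
    rintro _ ⟨t, ⟨_, ht⟩, rfl⟩
    exact hzero t ht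
  refine ⟨{{0}}, singleton_subset_iff.2 ⟨[0], ?_, ?_⟩, ?_⟩
  · rw [htile]
    exact singleton_nonempty 0
  · rw [htile, closure_singleton]
  · simp only [zero_mul, sUnion_singleton]
    exact hs.closure.image_const 0

/-! ### Tails of strings and lengths of tiles -/

/-- The value `∑ ωₖ x^{k+1}` of the fractional part `• ω₀ ω₁ ω₂ ⋯` in base `1 / x`. -/
noncomputable def fractionValue (x : ℝ) (ω : Str) : ℝ := ∑' k : ℕ, ((ω k : ℕ) : ℝ) * x ^ (k + 1)

/-- The value `∑ s_k B^{N-k}` of the integer part `s = s₀ ⋯ s_N`. -/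
noncomputable def integerValue (B : ℝ) (s : List (Fin 2)) : ℝ :=
  ∑ k : Fin s.length, ((s[k] : ℕ) : ℝ) * B ^ (((s.length - 1 : ℕ) : ℤ) - (k : ℤ))

theorem summable_digits_mul_pow {x : ℝ} (h0 : 0 ≤ x) (h1 : x < 1) (ω : Str) :
    Summable fun k : ℕ => ((ω k : ℕ) : ℝ) * x ^ (k + 1) := by
  refine Summable.of_nonneg_of_le (fun k => by positivity) (fun k => ?_)
    ((summable_nat_add_iff 1).2 (summable_geometric_of_lt_one h0 h1))
  have : ((ω k : ℕ) : ℝ) ≤ 1 := by exact_mod_cast Nat.le_of_lt_succ (ω k).isLt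
  exact mul_le_of_le_one_left (pow_nonneg h0 _) this

theorem radixMap_prepend {x : ℝ} (h0 : 0 ≤ x) (h1 : x < 1) {s : List (Fin 2)} (hs : s ≠ [])
    (τ : Str) : radixMap (1 / x) ⟨prepend s τ, s.length - 1⟩ =
      integerValue (1 / x) s + fractionValue x τ := by
  have hpos := List.length_pos_of_ne_nil hs
  have htail : (fun k : ℕ => ((prepend s τ (k + s.length) : ℕ) : ℝ) *
      (1 / x) ^ (((s.length - 1 : ℕ) : ℤ) - ((k + s.length : ℕ) : ℤ))) =
      fun k => ((τ k : ℕ) : ℝ) * x ^ (k + 1) := by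
    funext k
    -- The point follows index `s.length - 1`, so the tail starts at exponent `-1`.
    have he : ((s.length - 1 : ℕ) : ℤ) - ((k + s.length : ℕ) : ℤ) = -((k + 1 : ℕ) : ℤ) := by omega
    rw [he, one_div, inv_zpow', neg_neg, zpow_natCast, add_comm k s.length,
      ← shift_iterate_apply s.length (prepend s τ), shift_iterate_prepend]
  have hsum : Summable fun k : ℕ => ((prepend s τ k : ℕ) : ℝ) *
      (1 / x) ^ (((s.length - 1 : ℕ) : ℤ) - (k : ℤ)) :=
    (summable_nat_add_iff s.length).1 (by rw [htail]; exact summable_digits_mul_pow h0 h1 τ)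
  rw [radixMap, ← hsum.sum_add_tsum_nat_add s.length, htail, Finset.sum_range]
  refine congrArg₂ (· + ·) (Finset.sum_congr rfl fun k _ => ?_) rfl
  rw [prepend_apply_of_lt s τ k.isLt]
  rfl

theorem preTile_eq_image {x : ℝ} (h0 : 0 ≤ x) (h1 : x < 1) (Z : Set Str) {s : List (Fin 2)}
    (hs : s ≠ []) : preTile (withPoint Z) (radixMap (1 / x)) s =
      (fun y => integerValue (1 / x) s + y) '' (fractionValue x '' {τ | prepend s τ ∈ Z}) := by
  rw [image_image]
  have hpos := List.length_pos_of_ne_nil hs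
  ext y
  constructor
  · rintro ⟨⟨ω, N⟩, ⟨hω, rfl⟩, rfl⟩
    have hω' : prepend (Decimal.mk ω N).integerPart (shift^[N + 1] ω) = ω := prepend_ofFn (N + 1) ω
    refine ⟨shift^[N + 1] ω, ?_, ?_⟩
    · rw [mem_ofPred_eq, hω']
      exact hω
    · dsimp only
      rw [← radixMap_prepend h0 h1 hs, hω', length_integerPart, Nat.add_sub_cancel]
  · rintro ⟨τ, hτ, rfl⟩
    refine ⟨⟨prepend s τ, s.length - 1⟩, ⟨hτ, ?_⟩, radixMap_prepend h0 h1 hs τ⟩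
    refine List.ext_getElem (by rw [length_integerPart]; exact Nat.sub_add_cancel hpos) ?_
    intro k _ hk
    exact (List.getElem_ofFn _).trans (prepend_apply_of_lt s τ hk)

/-- Equality of strings as far as membership in `Z` and comparison with elements of `O` go. -/
def SameType (Z O : Set Str) (τ τ' : Str) : Prop :=
  (τ ∈ Z ↔ τ' ∈ Z) ∧ ∀ a ∈ O, (toLex τ ≤ toLex a ↔ toLex τ' ≤ toLex a) ∧
    (toLex τ < toLex a ↔ toLex τ' < toLex a)

/-- A saturated set is a preimage under the type map `Φ`, whose codomain is finite. -/
theorem finite_saturated (Z : Set Str) {O : Set Str} (hO : O.Finite) :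
    {X : Set Str | ∀ τ τ', SameType Z O τ τ' → (τ ∈ X ↔ τ' ∈ X)}.Finite := by
  have := hO.to_subtype
  let Φ : Str → Prop × (O → Prop × Prop) := fun τ =>
    (τ ∈ Z, fun a => (toLex τ ≤ toLex a.1, toLex τ < toLex a.1))
  refine (finite_range fun Y : Set (Prop × (O → Prop × Prop)) => Φ ⁻¹' Y).subset fun X hX => ?_
  refine ⟨Φ '' X, Subset.antisymm ?_ (subset_preimage_image Φ X)⟩
  rintro τ ⟨τ', hτ', h⟩
  simp only [Φ, Prod.mk.injEq, funext_iff, Subtype.forall, eq_iff_iff] at h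
  exact (hX τ' τ h).1 hτ'

/-- Either `c` and `a 0` decide the comparison, or it passes to `shift a`; hence `O` will be taken
closed under the shift. -/
theorem SameType.compare_cons {Z O : Set Str} {τ τ' : Str} (h : SameType Z O τ τ') (c : Fin 2)
    {a : Str} (ha : shift a ∈ O) :
    (toLex (cons c τ) ≤ toLex a ↔ toLex (cons c τ') ≤ toLex a) ∧
      (toLex (cons c τ) < toLex a ↔ toLex (cons c τ') < toLex a) := by
  simp only [toLex_le_iff (cons _ _), toLex_lt_iff (cons _ _), cons_zero, shift_cons,
    (h.2 _ ha).1, (h.2 _ ha).2, and_self]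

theorem mem_addressSpace_iff (α β : Str) (ε : Side) (ω : Str) :
    ω ∈ addressSpace α β ε ↔ shift ω ∈ addressSpace α β ε ∧
      match ε with
      | .minus => toLex ω ∉ Ioc (toLex α) (toLex β)
      | .plus => toLex ω ∉ Ico (toLex α) (toLex β) := by
  cases ε <;>
  exact ⟨fun h => ⟨fun n => h (n + 1), h 0⟩, fun h n => n.casesOn h.2 h.1⟩

theorem SameType.cons {α β : Str} {ε : Side} {O : Set Str} (hα : α ∈ O) (hβ : β ∈ O)
    (hO : ∀ a ∈ O, shift a ∈ O) {τ τ' : Str} (h : SameType (addressSpace α β ε) O τ τ')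
    (c : Fin 2) : SameType (addressSpace α β ε) O (cons c τ) (cons c τ') := by
  have hcmp := fun a ha => h.compare_cons c (hO a ha)
  refine ⟨?_, hcmp⟩
  rw [mem_addressSpace_iff, mem_addressSpace_iff α β ε (RadixTiling.cons c τ'), shift_cons,
    shift_cons, h.1]
  refine and_congr_right fun _ => ?_
  cases ε with
  | minus =>
    -- By linearity of the order, `cτ ≤ α` also settles `α < cτ`.
    exact not_congr (and_congr (le_iff_le_iff_lt_iff_lt.1 (hcmp α hα).1) (hcmp β hβ).1)
  | plus =>
    exact not_congr (and_congr (le_iff_le_iff_lt_iff_lt.2 (hcmp α hα).2) (hcmp β hβ).2)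

theorem SameType.prepend {α β : Str} {ε : Side} {O : Set Str} (hα : α ∈ O) (hβ : β ∈ O)
    (hO : ∀ a ∈ O, shift a ∈ O) {τ τ' : Str} (h : SameType (addressSpace α β ε) O τ τ')
    (s : List (Fin 2)) :
    SameType (addressSpace α β ε) O (prepend s τ) (prepend s τ') := by
  induction s with
  | nil => exact h
  | cons c s ih => exact ih.cons hα hβ hO c

theorem SameType.mem_addressSpaceZero_iff {α β : Str} {ε : Side} {O : Set Str}
    (hα : shift α ∈ O) {τ τ' : Str} (h : SameType (addressSpace α β ε) O τ τ') :
    τ ∈ addressSpaceZero α β ε ↔ τ' ∈ addressSpaceZero α β ε := by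
  have hcmp := h.compare_cons 0 hα
  cases ε with
  | minus => exact and_congr h.1 hcmp.1
  | plus => exact and_congr h.1 hcmp.2

theorem IsEventuallyPeriodic.finite_orbit {ω : Str} (h : IsEventuallyPeriodic ω) :
    (range fun n : ℕ => shift^[n] ω).Finite := by
  obtain ⟨m, p, hp, hper⟩ := h
  have hpt : Function.IsPeriodicPt shift p (shift^[m] ω) := funext fun k => by
    rw [shift_iterate_apply, add_comm]
    exact hper k
  refine ((finite_lt_nat (m + p)).image fun n => shift^[n] ω).subset ?_
  rintro _ ⟨n, rfl⟩
  rcases lt_or_ge n m with hn | hn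
  · exact ⟨n, by simp only [mem_ofPred_eq]; omega, rfl⟩
  · refine ⟨(n - m) % p + m, ?_, ?_⟩
    · have := Nat.mod_lt (n - m) hp
      simp only [mem_ofPred_eq]
      omega
    · simp only [Function.iterate_add_apply]
      rw [hpt.iterate_mod_apply, ← Function.iterate_add_apply, Nat.sub_add_cancel hn]

theorem finite_tileLengths {α β : Str} (hα : IsEventuallyPeriodic α)
    (hβ : IsEventuallyPeriodic β) (ε : Side) {x : ℝ} (h0 : 0 ≤ x) (h1 : x < 1) :
    (tileLengths (tiling (withPoint (addressSpaceZero α β ε)) (radixMap (1 / x)))).Finite := by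
  set O : Set Str := (range fun n : ℕ => shift^[n] α) ∪ range fun n : ℕ => shift^[n] β with hO
  have hαO : α ∈ O := Or.inl ⟨0, rfl⟩
  have hβO : β ∈ O := Or.inr ⟨0, rfl⟩
  have hshift : ∀ a ∈ O, shift a ∈ O := by
    rintro _ (⟨n, rfl⟩ | ⟨n, rfl⟩)
    · exact Or.inl ⟨n + 1, Function.iterate_succ_apply' shift n α⟩
    · exact Or.inr ⟨n + 1, Function.iterate_succ_apply' shift n β⟩
  have hfin := finite_saturated (addressSpace α β ε) (hα.finite_orbit.union hβ.finite_orbit)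
  refine (hfin.image fun X => Metric.diam (fractionValue x '' X)).subset ?_
  rintro _ ⟨_, ⟨s, hs, rfl⟩, rfl⟩
  refine ⟨{τ | prepend s τ ∈ addressSpaceZero α β ε}, fun τ τ' h => ?_, ?_⟩
  · exact (h.prepend hαO hβO hshift s).mem_addressSpaceZero_iff (hshift α hαO)
  · dsimp only
    -- Neither closure nor translation by the integer part changes the diameter.
    rw [Metric.diam_closure, preTile_eq_image h0 h1 _ (ne_nil_of_preTile_nonempty hs),
      (isometry_add_left _).diam_image]

end RadixTiling

theorem mainTheorem5 (α β : RadixTiling.Str)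
    (hadm : RadixTiling.IsAdmissible α β) (hnull : ¬ RadixTiling.IsNull α β)
    (ε : RadixTiling.Side) :
    RadixTiling.IsSelfReplicating (RadixTiling.base α β) (RadixTiling.pairTiling α β ε) ∧
    (RadixTiling.IsEventuallyPeriodic α → RadixTiling.IsEventuallyPeriodic β →
      (RadixTiling.tileLengths (RadixTiling.pairTiling α β ε)).Finite) := by
  refine ⟨?_, fun hα hβ => RadixTiling.finite_tileLengths hα hβ ε
    (RadixTiling.sInf_solutions_nonneg α β) (RadixTiling.sInf_solutions_lt_one α β)⟩
  rw [RadixTiling.pairTiling]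
  -- The base vanishes only if `solutions α β` is empty, since all solutions are at least `1/2`.
  by_cases hB : RadixTiling.base α β = 0
  · rw [hB]
    exact RadixTiling.isSelfReplicating_zero (RadixTiling.zero_mem_addressSpaceZero hadm ε)
  · exact RadixTiling.isSelfReplicating_tiling hB _
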